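/- Let $K,L\ge 0$ and $N\ge 1$ be integers, $\mathcal X\subseteq\mathbb R^L$ a compact polyhedron, $\mathbf c,\mathbf a\in\mathbb R^L$, $\mathbf A\in\mathbb R^{L\times K}$, $\mathbf b\in\mathbb R^K$, $b\in\mathbb R$, $\theta\ge 0$, $\varepsilon\in(0,1]$, and let $\hat{\boldsymbol\xi}_1,\dots,\hat{\boldsymbol\xi}_N\in\mathbb R^K$ be samples. Let $\|\cdot\|$ be any norm on $\mathbb R^K$, with dual norm $\|\mathbf v\|_*=\sup\{\mathbf v^\top\mathbf u:\|\mathbf u\|\le 1\}$, and let $\hat{\mathbb P}=\frac1N\sum_{i=1}^N\delta_{\hat{\boldsymbol\xi}_i}$. Let $\mathcal F(\theta)$ be the set of all Borel probability measures $\mathbb P$ on $\mathbb R^K$ with $d_{\rm W}(\mathbb P,\hat{\mathbb P})\le\theta$, where $d_{\rm W}(\mathbb P_1,\mathbb P_2)$ is the infimum of $\mathbb E_{\mathbb Q}[\|\boldsymbol\xi_1-\boldsymbol\xi_2\|]$ over all joint distributions $\mathbb Q$ on $\mathbb R^K\times\mathbb R^K$ with marginals $\mathbb P_1$ and $\mathbb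 P_2$ (the type-1 Wasserstein distance). For measurable $\ell:\mathbb R^K\to\mathbb R$ put $\mathbb P\text{-CVaR}_\varepsilon(\ell(\tilde{\boldsymbol\xi}))=\inf_{\tau\in\mathbb R}\{\tau+\frac1\varepsilon\mathbb E_{\mathbb P}[(\ell(\tilde{\boldsymbol\xi})-\tau)^+]\}$. Consider the worst-case CVaR constrained program $$Z^\star_{\rm CVaR}=\min_{\mathbf x\in\mathcal X}\Big\{\mathbf c^\top\mathbf x \;:\; \sup_{\mathbb P\in\mathcal F(\theta)}\mathbb P\text{-CVaR}_\varepsilon\big(\mathbf a^\top\mathbf x-b+(\mathbf A^\top\mathbf x-\mathbf b)^\top\tilde{\boldsymbol\xi}\big)\le 0\Big\}$$ and, for slopes $\boldsymbol\kappa\in[0,1]^N$, the program $Z^\star_{\rm ICC}(\boldsymbol\kappa)=\min\{\mathbf c^\top\mathbf x:(\mathbf x,\mathbf s,t)\in\mathcal C_{\rm ICC}(\boldsymbol\kappa)\}$, where $\mathcal C_{\rm ICC}(\boldsymbol\kappa)$ is the set of all $(\mathbf x,\mathbf s,t)\in\mathcal X\times\mathbb R^N_+\times\mathbb R$ with $$\varepsilon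 N t-\sum_{i=1}^N s_i\ge\theta N\|\mathbf b-\mathbf A^\top\mathbf x\|_*,\qquad \kappa_i\big((\mathbf b-\mathbf A^\top\mathbf x)^\top\hat{\boldsymbol\xi}_i+b-\mathbf a^\top\mathbf x\big)\ge t-s_i\quad(i=1,\dots,N).$$ The optimal value of an infeasible program is $+\infty$. Let $\mathbf e=(1,\dots,1)^\top\in\mathbb R^N$. Then $$Z^\star_{\rm CVaR}=Z^\star_{\rm ICC}(\mathbf e),$$ and the minimum in each of these two programs is attained whenever the program is feasible. -/

import Mathlib

open MeasureTheory
open scoped ENNReal Matrix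

noncomputable section

/-- The dual `‖v‖_* = sup {vᵀ u : ‖u‖ ≤ 1}` of a norm on `ℝᴷ`. -/
def dualNorm {K : ℕ} (nrm : Seminorm ℝ (Fin K → ℝ)) (v : Fin K → ℝ) : ℝ :=
  sSup {r : ℝ | ∃ u : Fin K → ℝ, nrm u ≤ 1 ∧ r = v ⬝ᵥ u}

/-- The empirical distribution `(1/N) ∑ᵢ δ_{ξᵢ}`. -/
def empiricalMeasure {K N : ℕ} (ξ : Fin N → Fin K → ℝ) : Measure (Fin K → ℝ) :=
  (N : ℝ≥0∞)⁻¹ • ∑ i, Measure.dirac (ξ i)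

/-- The joint distributions on `ℝᴷ × ℝᴷ` with marginals `μ` and `ν`. -/
def couplings {K : ℕ} (μ ν : Measure (Fin K → ℝ)) :
    Set (Measure ((Fin K → ℝ) × (Fin K → ℝ))) :=
  {π | π.map Prod.fst = μ ∧ π.map Prod.snd = ν}

/-- The type-1 Wasserstein distance with respect to a norm on `ℝᴷ`, with values in `[0, ∞]`. -/
def wassersteinDist {K : ℕ} (nrm : Seminorm ℝ (Fin K → ℝ)) (μ ν : Measure (Fin K → ℝ)) : ℝ≥0∞ :=
  ⨅ π ∈ couplings μ ν, ∫⁻ z, ENNReal.ofReal (nrm (z.1 - z.2)) ∂π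

/-- The Wasserstein ball of radius `θ` around the empirical distribution: all Borel probability
measures on `ℝᴷ` within distance `θ`. -/
def wassersteinBall {K N : ℕ} (nrm : Seminorm ℝ (Fin K → ℝ)) (ξ : Fin N → Fin K → ℝ) (θ : ℝ) :
    Set (Measure (Fin K → ℝ)) :=
  {P | IsProbabilityMeasure P ∧ wassersteinDist nrm P (empiricalMeasure ξ) ≤ ENNReal.ofReal θ}

/-- The conditional value-at-risk `inf {τ + E_P[(ℓ - τ)⁺] / ε : τ ∈ ℝ}` as an extended real; the
expectation of the nonnegative variable `(ℓ - τ)⁺` is taken in `[0, ∞]`. -/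
def cvar {Ω : Type*} [MeasurableSpace Ω] (P : Measure Ω) (ε : ℝ) (ℓ : Ω → ℝ) : EReal :=
  ⨅ τ : ℝ, (τ : EReal) +
    (((∫⁻ ω, ENNReal.ofReal (max (ℓ ω - τ) 0) ∂P) / ENNReal.ofReal ε : ℝ≥0∞) : EReal)

/-- A polyhedron in `ℝᴸ`: the solution set of finitely many weak linear inequalities. -/
def IsPolyhedron {L : ℕ} (X : Set (Fin L → ℝ)) : Prop :=
  ∃ (m : ℕ) (G : Matrix (Fin m) (Fin L) ℝ) (h : Fin m → ℝ), X = {x | G *ᵥ x ≤ h}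

/-- The data of a chance constrained program over a Wasserstein ball with an individual chance
constraint: the safety set of `x` is `{ξ | (A ξ + a)ᵀ x < bᵀ ξ + b₀}`. -/
structure ICCProgram (K L N : ℕ) where
  /-- the set of admissible decisions -/
  X : Set (Fin L → ℝ)
  /-- the cost vector -/
  c : Fin L → ℝ
  A : Matrix (Fin L) (Fin K) ℝ
  a : Fin L → ℝ
  b : Fin K → ℝ
  b₀ : ℝ
  /-- the norm on `ℝᴷ` (definiteness is a hypothesis of the theorem) -/
  nrm : Seminorm ℝ (Fin K → ℝ)
  /-- the training samples -/
  sample : Fin N → Fin K → ℝ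
  /-- the Wasserstein radius -/
  θ : ℝ
  /-- the risk level -/
  ε : ℝ

namespace ICCProgram

variable {K L N : ℕ} (D : ICCProgram K L N)

/-- The loss `aᵀ x - b₀ + (Aᵀ x - b)ᵀ ξ`. -/
def loss (x : Fin L → ℝ) (ξ : Fin K → ℝ) : ℝ :=
  D.a ⬝ᵥ x - D.b₀ + (D.Aᵀ *ᵥ x - D.b) ⬝ᵥ ξ

/-- The worst-case CVaR of the loss over the Wasserstein ball. -/
def worstCaseCVaR (x : Fin L → ℝ) : EReal :=
  ⨆ P ∈ wassersteinBall D.nrm D.sample D.θ, cvar P D.ε (D.loss x)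

/-- The feasible set of the worst-case CVaR constrained program. -/
def feasibleCVaR : Set (Fin L → ℝ) :=
  {x | x ∈ D.X ∧ D.worstCaseCVaR x ≤ 0}

/-- The optimal value of the worst-case CVaR constrained program (`⊤` if it is infeasible). -/
def ZCVaR : EReal :=
  ⨅ x ∈ D.feasibleCVaR, ((D.c ⬝ᵥ x : ℝ) : EReal)

/-- The inner approximation with slope parameters `κ`, a set of triples `(x, s, t)`. -/
def CICC (κ : Fin N → ℝ) : Set ((Fin L → ℝ) × (Fin N → ℝ) × ℝ) :=
  {y | y.1 ∈ D.X ∧ (∀ i, 0 ≤ y.2.1 i) ∧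
    D.ε * N * y.2.2 - ∑ i, y.2.1 i ≥ D.θ * N * dualNorm D.nrm (D.b - D.Aᵀ *ᵥ y.1) ∧
    ∀ i, κ i * ((D.b - D.Aᵀ *ᵥ y.1) ⬝ᵥ D.sample i + D.b₀ - D.a ⬝ᵥ y.1) ≥ y.2.2 - y.2.1 i}

/-- The optimal value of the inner approximation with slopes `κ` (`⊤` if it is infeasible). -/
def ZICC (κ : Fin N → ℝ) : EReal :=
  ⨅ y ∈ D.CICC κ, ((D.c ⬝ᵥ y.1 : ℝ) : EReal)

end ICCProgram

end

/-! Three sets of decisions coincide: `feasibleCVaR`, `dualFeasible` and the projection of `CICC` at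
unit slopes. A cycle of inclusions shows this. Moving an ε-tail of the empirical law by a vector of
norm at most θ/ε costs at most θ, so the worst-case CVaR dominates, up to the factor ε, every affine
expression in `dualFeasible`. The tail above an empirical quantile τ, with the supremum over
directions, then gives the dual-norm constraint for t = -τ. Finally the loss is Lipschitz with the
dual norm as constant, so the single choice τ = -t bounds the CVaR over the whole ball. Attainment
follows because `dualFeasible` is cut out of the compact set X by weak affine inequalities. -/

/-- The dual norm of a definite seminorm on `ℝᴷ` is a supremum of a bounded set. -/
theorem bddAbove_dualNorm {K : ℕ} (nrm : Seminorm ℝ (Fin K → ℝ)) (hnrm : ∀ v, nrm v = 0 → v = 0)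
    (v : Fin K → ℝ) : BddAbove {r : ℝ | ∃ u : Fin K → ℝ, nrm u ≤ 1 ∧ r = v ⬝ᵥ u} := by
  have hcont : Continuous nrm :=
    continuousOn_univ.mp (nrm.convexOn.continuousOn isOpen_univ)
  have hdot : Continuous fun u : Fin K → ℝ => v ⬝ᵥ u := by
    unfold dotProduct; fun_prop
  obtain ⟨C, hC0, hC⟩ : ∃ C : ℝ, 0 ≤ C ∧ ∀ u ∈ Metric.sphere (0 : Fin K → ℝ) 1,
      v ⬝ᵥ u ≤ C * nrm u := by
    -- The sphere is empty when K = 0.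
    rcases (Metric.sphere (0 : Fin K → ℝ) 1).eq_empty_or_nonempty with he | hne
    · exact ⟨0, le_rfl, by simp [he]⟩
    have hpos : ∀ u ∈ Metric.sphere (0 : Fin K → ℝ) 1, 0 < nrm u := fun u hu =>
      (apply_nonneg nrm u).lt_of_ne fun h => by simp [hnrm u h.symm] at hu
    obtain ⟨m, hm, hmin⟩ := (isCompact_sphere (0 : Fin K → ℝ) 1).exists_isMaxOn hne
      (hdot.continuousOn.div hcont.continuousOn fun u hu => (hpos u hu).ne')
    refine ⟨max (v ⬝ᵥ m / nrm m) 0, le_max_right _ _, fun u hu => ?_⟩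
    rw [← div_le_iff₀ (hpos u hu)]
    exact (hmin hu).trans (le_max_left _ _)
  refine ⟨C, ?_⟩
  rintro _ ⟨u, hu, rfl⟩
  rcases eq_or_ne u 0 with rfl | hu0
  · simpa using hC0
  have hn : 0 < ‖u‖ := norm_pos_iff.mpr hu0
  have h := hC (‖u‖⁻¹ • u) (by simp [norm_smul, hn.ne'])
  rw [dotProduct_smul, map_smul_eq_mul, smul_eq_mul, Real.norm_of_nonneg (by positivity),
    mul_left_comm, mul_le_mul_iff_right₀ (by positivity)] at h
  exact h.trans (mul_le_of_le_one_right hC0 hu)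

theorem dotProduct_le_dualNorm_mul {K : ℕ} (nrm : Seminorm ℝ (Fin K → ℝ))
    (hnrm : ∀ v, nrm v = 0 → v = 0) (v u : Fin K → ℝ) : v ⬝ᵥ u ≤ dualNorm nrm v * nrm u := by
  rcases eq_or_ne (nrm u) 0 with h | h
  · simp [hnrm u h]
  have hp : 0 < nrm u := (apply_nonneg nrm u).lt_of_ne' h
  -- Boundedness matters: `sSup` of an unbounded set of reals is 0.
  have := le_csSup (bddAbove_dualNorm nrm hnrm v)
    ⟨(nrm u)⁻¹ • u, by
      rw [map_smul_eq_mul, Real.norm_of_nonneg (by positivity), inv_mul_cancel₀ h], rfl⟩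
  rw [dotProduct_smul, smul_eq_mul, inv_mul_le_iff₀ hp, mul_comm] at this
  exact this

theorem dualNorm_nonneg {K : ℕ} (nrm : Seminorm ℝ (Fin K → ℝ))
    (hnrm : ∀ v, nrm v = 0 → v = 0) (v : Fin K → ℝ) : 0 ≤ dualNorm nrm v :=
  le_csSup (bddAbove_dualNorm nrm hnrm v) ⟨0, by simp⟩

/-! ### Expectations and the Wasserstein distance -/

theorem lintegral_empiricalMeasure {K N : ℕ} (ξ : Fin N → Fin K → ℝ) (f : (Fin K → ℝ) → ℝ≥0∞) :
    ∫⁻ z, f z ∂(empiricalMeasure ξ) = (N : ℝ≥0∞)⁻¹ * ∑ i, f (ξ i) := by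
  simp [empiricalMeasure]

/-- If `f ≤ g + C ‖· - ·‖`, the expectations of `f` and `g` differ by at most `C` times the
Wasserstein distance. -/
theorem lintegral_le_add_mul_wassersteinDist {K : ℕ} (nrm : Seminorm ℝ (Fin K → ℝ))
    {μ ν : Measure (Fin K → ℝ)} {f g : (Fin K → ℝ) → ℝ≥0∞} (hf : Measurable f) (hg : Measurable g)
    {C r : ℝ≥0∞} (hC : C ≠ ∞) (hr : r ≠ ∞)
    (hfg : ∀ y z, f y ≤ g z + C * ENNReal.ofReal (nrm (y - z)))
    (hd : wassersteinDist nrm μ ν ≤ r) :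
    ∫⁻ z, f z ∂μ ≤ ∫⁻ z, g z ∂ν + C * r := by
  -- No optimal coupling is assumed: one of cost below r' exists for each r' > r, and r' then
  -- decreases to r.
  have key : ∀ r' : ℝ≥0∞, r < r' → ∫⁻ z, f z ∂μ ≤ ∫⁻ z, g z ∂ν + C * r' := by
    intro r' hr'
    obtain ⟨π, hπ⟩ := iInf_lt_iff.mp (hd.trans_lt hr')
    obtain ⟨⟨h1, h2⟩, hπ⟩ := iInf_lt_iff.mp hπ
    rw [← h1, ← h2, lintegral_map hf measurable_fst, lintegral_map hg measurable_snd]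
    calc ∫⁻ z, f z.1 ∂π ≤ ∫⁻ z, (g z.2 + C * ENNReal.ofReal (nrm (z.1 - z.2))) ∂π :=
          lintegral_mono fun z => hfg z.1 z.2
      _ = ∫⁻ z, g z.2 ∂π + C * ∫⁻ z, ENNReal.ofReal (nrm (z.1 - z.2)) ∂π := by
          rw [lintegral_add_left (by fun_prop), lintegral_const_mul' _ _ hC]
      _ ≤ _ := by gcongr
  have hlim : Filter.Tendsto (fun r' => ∫⁻ z, g z ∂ν + C * r') (nhdsWithin r (Set.Ioi r))
      (nhds (∫⁻ z, g z ∂ν + C * r)) :=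
    ((ENNReal.Tendsto.const_mul Filter.tendsto_id (Or.inr hC)).const_add _).mono_left
      nhdsWithin_le_nhds
  have : (nhdsWithin r (Set.Ioi r)).NeBot := nhdsGT_neBot_of_exists_gt ⟨∞, hr.lt_top⟩
  exact ge_of_tendsto hlim (Filter.eventually_of_mem self_mem_nhdsWithin key)

/-! ### Empirical tails and shifted measures -/

/-- The weights of the empirical tail: they have total mass `ε` and put at most mass `1 / N` on
each sample. -/
def tailWeights (N : ℕ) (ε : ℝ) : Set (Fin N → ℝ) :=
  {w | (∀ i, 0 ≤ w i) ∧ (∀ i, w i ≤ (N : ℝ)⁻¹) ∧ ∑ i, w i = ε}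

/-- A quantile `τ` of finitely many values, with tail weights concentrated above it. -/
theorem exists_quantile_tailWeights {N : ℕ} (hN : 0 < N) {ε : ℝ} (hε0 : 0 < ε) (hε1 : ε ≤ 1)
    (l : Fin N → ℝ) :
    ∃ τ : ℝ, ∃ w ∈ tailWeights N ε, ∀ i, w i * (l i - τ) = (N : ℝ)⁻¹ * max (l i - τ) 0 := by
  classical
  have hNR : (0 : ℝ) < N := by exact_mod_cast hN
  have : Nonempty (Fin N) := ⟨⟨0, hN⟩⟩
  -- `T r` is the empirical mass of the values at least r; τ will be the largest sample value `l j`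
  -- with `ε ≤ T (l j)`.
  let T : ℝ → ℝ := fun r => ∑ i, if r ≤ l i then (N : ℝ)⁻¹ else 0
  let S := Finset.univ.filter fun j => ε ≤ T (l j)
  have hS : S.Nonempty := by
    obtain ⟨j, hj⟩ := Finite.exists_min l
    refine ⟨j, Finset.mem_filter.mpr ⟨Finset.mem_univ _, ?_⟩⟩
    simp only [T, hj, if_true, Finset.sum_const, Finset.card_univ, Fintype.card_fin, nsmul_eq_mul]
    rwa [mul_inv_cancel₀ hNR.ne']
  obtain ⟨j, hjS, hj⟩ := S.exists_max_image l hS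
  have hq : ε ≤ T (l j) := (Finset.mem_filter.mp hjS).2
  let p : ℝ := ∑ i, if l j < l i then (N : ℝ)⁻¹ else 0
  have hp : p ≤ ε := by
    rcases (Finset.univ.filter fun i => l j < l i).eq_empty_or_nonempty with he | hne
    · have : p = 0 := Finset.sum_eq_zero fun i _ => if_neg fun h => by
        have : i ∈ Finset.univ.filter fun i => l j < l i := by simpa using h
        simp [he] at this
      rw [this]; exact hε0.le
    · obtain ⟨k, hk, hkmin⟩ := Finset.exists_min_image _ l hne
      have hk' : l j < l k := by simpa using hk
      -- The strict tail above `l j` is the weak tail at the next larger value, so maximality of `l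
      -- j` bounds its mass.
      have hpT : p = T (l k) := Finset.sum_congr rfl fun i _ => by
        have : l j < l i ↔ l k ≤ l i :=
          ⟨fun h => hkmin i (by simpa using h), fun h => hk'.trans_le h⟩
        simp only [this]
      rw [hpT]
      by_contra! h
      exact (hj k (Finset.mem_filter.mpr ⟨Finset.mem_univ _, h.le⟩)).not_gt hk'
  -- Mixing the strict and weak tails gives mass exactly ε. Only the weights at the value τ depend
  -- on c, and there `l i - τ` vanishes.
  obtain ⟨c, ⟨hc0, hc1⟩, hc⟩ : ∃ c ∈ Set.Icc (0 : ℝ) 1, (1 - c) * p + c * T (l j) = ε := by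
    rcases hp.eq_or_lt with h | h
    · exact ⟨0, by simp, by simp [h]⟩
    · have hd : 0 < T (l j) - p := by linarith
      refine ⟨(ε - p) / (T (l j) - p), ⟨by apply div_nonneg <;> linarith, ?_⟩, ?_⟩
      · rw [div_le_one hd]; linarith
      · field_simp; ring
  have hNi : 0 ≤ (N : ℝ)⁻¹ := by positivity
  refine ⟨l j, fun i => (1 - c) * (if l j < l i then (N : ℝ)⁻¹ else 0) +
    c * (if l j ≤ l i then (N : ℝ)⁻¹ else 0), ⟨fun i => ?_, fun i => ?_, ?_⟩, fun i => ?_⟩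
  · have : 0 ≤ 1 - c := by linarith
    positivity
  · dsimp only
    split_ifs <;> nlinarith
  · rw [Finset.sum_add_distrib, ← Finset.mul_sum, ← Finset.mul_sum]
    exact hc
  · dsimp only
    rcases lt_trichotomy (l j) (l i) with h | h | h
    · rw [if_pos h, if_pos h.le, max_eq_left (by linarith)]; ring
    · simp [h]
    · rw [if_neg h.not_gt, if_neg h.not_ge, max_eq_right (by linarith)]; ring

/-- The coupling that moves the mass `w i` of each sample `ξ i` by `d` and keeps the rest. -/
noncomputable def shiftCoupling {K N : ℕ} (ξ : Fin N → Fin K → ℝ) (w : Fin N → ℝ) (d : Fin K → ℝ) :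
    Measure ((Fin K → ℝ) × (Fin K → ℝ)) :=
  ∑ i, (ENNReal.ofReal (w i) • Measure.dirac (ξ i + d, ξ i) +
    ENNReal.ofReal ((N : ℝ)⁻¹ - w i) • Measure.dirac (ξ i, ξ i))

theorem lintegral_shiftCoupling {K N : ℕ} (ξ : Fin N → Fin K → ℝ) (w : Fin N → ℝ)
    (d : Fin K → ℝ) (f : (Fin K → ℝ) × (Fin K → ℝ) → ℝ≥0∞) :
    ∫⁻ z, f z ∂(shiftCoupling ξ w d) = ∑ i, (ENNReal.ofReal (w i) * f (ξ i + d, ξ i) +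
      ENNReal.ofReal ((N : ℝ)⁻¹ - w i) * f (ξ i, ξ i)) := by
  simp [shiftCoupling, lintegral_add_measure]

theorem shiftCoupling_map_snd {K N : ℕ} (hN : 0 < N) (ξ : Fin N → Fin K → ℝ) {ε : ℝ}
    {w : Fin N → ℝ} (hw : w ∈ tailWeights N ε) (d : Fin K → ℝ) :
    (shiftCoupling ξ w d).map Prod.snd = empiricalMeasure ξ := by
  refine Measure.ext_of_lintegral _ fun f hf => ?_
  rw [lintegral_map hf measurable_snd, lintegral_shiftCoupling, lintegral_empiricalMeasure,
    Finset.mul_sum]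
  refine Finset.sum_congr rfl fun i _ => ?_
  rw [← add_mul, ← ENNReal.ofReal_add (hw.1 i) (sub_nonneg.mpr (hw.2.1 i)), add_sub_cancel,
    ENNReal.ofReal_inv_of_pos (by exact_mod_cast hN), ENNReal.ofReal_natCast]

theorem isProbabilityMeasure_empiricalMeasure {K N : ℕ} (hN : 0 < N) (ξ : Fin N → Fin K → ℝ) :
    IsProbabilityMeasure (empiricalMeasure ξ) := by
  constructor
  rw [← lintegral_one, lintegral_empiricalMeasure]
  simp [ENNReal.inv_mul_cancel (Nat.cast_ne_zero.mpr hN.ne') (ENNReal.natCast_ne_top N)]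

theorem shiftCoupling_map_fst_mem_wassersteinBall {K N : ℕ} (hN : 0 < N)
    (nrm : Seminorm ℝ (Fin K → ℝ)) (ξ : Fin N → Fin K → ℝ) {ε θ : ℝ} {w : Fin N → ℝ}
    (hw : w ∈ tailWeights N ε) {d : Fin K → ℝ} (hd : ε * nrm d ≤ θ) :
    (shiftCoupling ξ w d).map Prod.fst ∈ wassersteinBall nrm ξ θ := by
  have hsnd := shiftCoupling_map_snd hN ξ hw d
  constructor
  · have : IsProbabilityMeasure ((shiftCoupling ξ w d).map Prod.snd) :=
      hsnd ▸ isProbabilityMeasure_empiricalMeasure hN ξ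
    have : IsProbabilityMeasure (shiftCoupling ξ w d) :=
      Measure.isProbabilityMeasure_of_map Prod.snd
    exact Measure.isProbabilityMeasure_map measurable_fst.aemeasurable
  · refine (iInf₂_le (shiftCoupling ξ w d) ⟨rfl, hsnd⟩).trans ?_
    rw [lintegral_shiftCoupling]
    simp only [add_sub_cancel_left, sub_self, map_zero, ENNReal.ofReal_zero, mul_zero, add_zero]
    rw [← Finset.sum_mul, ← ENNReal.ofReal_sum_of_nonneg fun i _ => hw.1 i, hw.2.2,
      ← ENNReal.ofReal_mul' (apply_nonneg nrm d)]
    exact ENNReal.ofReal_le_ofReal hd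

/-! ### The cycle of inclusions and attainment -/

namespace ICCProgram

variable {K L N : ℕ} (D : ICCProgram K L N)

theorem measurable_loss (x : Fin L → ℝ) : Measurable (D.loss x) := by
  unfold loss dotProduct; fun_prop

theorem loss_eq_neg (x : Fin L → ℝ) (ξ : Fin K → ℝ) :
    D.loss x ξ = -((D.b - D.Aᵀ *ᵥ x) ⬝ᵥ ξ + D.b₀ - D.a ⬝ᵥ x) := by
  simp only [loss, sub_dotProduct]; ring

theorem loss_add (x : Fin L → ℝ) (ξ d : Fin K → ℝ) :
    D.loss x (ξ + d) = D.loss x ξ - (D.b - D.Aᵀ *ᵥ x) ⬝ᵥ d := by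
  simp only [loss, sub_dotProduct, dotProduct_add]; ring

/-- The decisions at which all the affine minorants of the worst-case CVaR, one for each tail
weight and each direction in the unit ball, are nonpositive. -/
def dualFeasible : Set (Fin L → ℝ) :=
  {x | x ∈ D.X ∧ ∀ w ∈ tailWeights N D.ε, ∀ u, D.nrm u ≤ 1 →
    ∑ i, w i * D.loss x (D.sample i) + D.θ * ((D.b - D.Aᵀ *ᵥ x) ⬝ᵥ u) ≤ 0}

theorem feasibleCVaR_subset_dualFeasible (hN : 0 < N) (hθ : 0 ≤ D.θ) (hε0 : 0 < D.ε) :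
    D.feasibleCVaR ⊆ D.dualFeasible := by
  rintro x ⟨hxX, hx⟩
  refine ⟨hxX, fun w hw u hu => ?_⟩
  -- Mass ε moved by θ/ε exhausts the budget θ; the minus sign is there because the loss has
  -- gradient -v.
  set d : Fin K → ℝ := (-(D.θ / D.ε)) • u with hd
  have hnd : D.ε * D.nrm d ≤ D.θ := by
    rw [hd, neg_smul, map_neg_eq_map, map_smul_eq_mul, Real.norm_of_nonneg (by positivity),
      ← mul_assoc, mul_div_cancel₀ _ hε0.ne']
    exact mul_le_of_le_one_right hθ hu
  have hP := shiftCoupling_map_fst_mem_wassersteinBall hN D.nrm D.sample hw hnd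
  set v := D.b - D.Aᵀ *ᵥ x with hv
  set R := ∑ i, w i * D.loss x (D.sample i) + D.θ * (v ⬝ᵥ u) with hR
  have h0 : cvar _ D.ε (D.loss x) ≤ 0 := (le_iSup₂ (α := EReal)
    (f := fun P (_ : P ∈ wassersteinBall D.nrm D.sample D.θ) => cvar P D.ε (D.loss x)) _ hP).trans hx
  have h1 : ((R / D.ε : ℝ) : EReal) ≤ cvar ((shiftCoupling D.sample w d).map Prod.fst) D.ε
      (D.loss x) := by
    refine le_iInf fun τ => ?_
    have hm : Measurable fun ξ => ENNReal.ofReal (max (D.loss x ξ - τ) 0) :=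
      (((D.measurable_loss x).sub_const τ).max measurable_const).ennreal_ofReal
    rw [lintegral_map hm measurable_fst, lintegral_shiftCoupling]
    -- The mass left in place contributes a nonnegative term, which is dropped; on the moved mass
    -- the positive part is at least its argument.
    have hsum : ENNReal.ofReal (R - D.ε * τ) ≤
        ∑ i, (ENNReal.ofReal (w i) * ENNReal.ofReal (max (D.loss x (D.sample i + d) - τ) 0) +
          ENNReal.ofReal ((N : ℝ)⁻¹ - w i) *
            ENNReal.ofReal (max (D.loss x (D.sample i) - τ) 0)) := by
      have : R - D.ε * τ = ∑ i, w i * (D.loss x (D.sample i + d) - τ) := by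
        simp only [D.loss_add, ← hv, hd, dotProduct_smul, smul_eq_mul, mul_sub,
          Finset.sum_sub_distrib, ← Finset.sum_mul, hw.2.2, hR]
        field_simp
        ring
      rw [this]
      refine (ENNReal.ofReal_le_ofReal (Finset.sum_le_sum fun i _ =>
        mul_le_mul_of_nonneg_left (le_max_left _ 0) (hw.1 i))).trans ?_
      rw [ENNReal.ofReal_sum_of_nonneg fun i _ => mul_nonneg (hw.1 i) (le_max_right _ _)]
      refine Finset.sum_le_sum fun i _ => ?_
      rw [ENNReal.ofReal_mul (hw.1 i)]
      exact le_self_add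
    have hdiv := ENNReal.div_le_div_right hsum (ENNReal.ofReal D.ε)
    rw [← ENNReal.ofReal_div_of_pos hε0] at hdiv
    calc ((R / D.ε : ℝ) : EReal) = (τ : EReal) + (((R - D.ε * τ) / D.ε : ℝ) : EReal) := by
          rw [← EReal.coe_add]; congr 1; field_simp; ring
      _ ≤ (τ : EReal) + ((ENNReal.ofReal ((R - D.ε * τ) / D.ε) : ℝ≥0∞) : EReal) := by
          gcongr
          rw [EReal.coe_ennreal_ofReal]
          exact EReal.coe_le_coe_iff.mpr (le_max_left _ _)
      _ ≤ _ := by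
          gcongr
          exact EReal.coe_ennreal_le_coe_ennreal_iff.mpr hdiv
  have h2 : R / D.ε ≤ 0 := by exact_mod_cast h1.trans h0
  simpa using (div_le_iff₀ hε0).mp h2

theorem dualFeasible_subset_CICC (hN : 0 < N) (hθ : 0 ≤ D.θ) (hε0 : 0 < D.ε) (hε1 : D.ε ≤ 1)
    {x : Fin L → ℝ} (hx : x ∈ D.dualFeasible) :
    ∃ s : Fin N → ℝ, ∃ t : ℝ, (x, s, t) ∈ D.CICC fun _ => 1 := by
  have hNR : (0 : ℝ) < N := by exact_mod_cast hN
  obtain ⟨τ, w, hw, hwτ⟩ := exists_quantile_tailWeights hN hε0 hε1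
    fun i => D.loss x (D.sample i)
  refine ⟨fun i => max (D.loss x (D.sample i) - τ) 0, -τ, hx.1, fun i => le_max_right _ _, ?_,
    fun i => ?_⟩
  · dsimp only
    set M := ∑ i, max (D.loss x (D.sample i) - τ) 0 with hM
    have hwl : ∑ i, w i * D.loss x (D.sample i) = (N : ℝ)⁻¹ * M + D.ε * τ := by
      rw [hM, Finset.mul_sum, ← Finset.sum_congr rfl fun i _ => hwτ i]
      simp only [mul_sub, Finset.sum_sub_distrib, ← Finset.sum_mul, hw.2.2]
      ring
    have hdual : D.θ * dualNorm D.nrm (D.b - D.Aᵀ *ᵥ x) ≤ -((N : ℝ)⁻¹ * M + D.ε * τ) := by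
      have hu : ∀ u, D.nrm u ≤ 1 →
          D.θ * ((D.b - D.Aᵀ *ᵥ x) ⬝ᵥ u) ≤ -((N : ℝ)⁻¹ * M + D.ε * τ) := fun u hu => by
        have := hx.2 w hw u hu
        linarith
      rcases hθ.eq_or_lt with h | h
      -- For θ = 0 division is impossible, but u = 0 already suffices.
      · simpa [← h] using hu 0 (by simp)
      · rw [mul_comm, ← le_div_iff₀ h]
        refine csSup_le ⟨_, 0, by simp, rfl⟩ ?_
        rintro _ ⟨u, hu1, rfl⟩
        rw [le_div_iff₀ h, mul_comm]
        exact hu u hu1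
    have := mul_le_mul_of_nonneg_right hdual hNR.le
    have e : -((N : ℝ)⁻¹ * M + D.ε * τ) * N = D.ε * N * -τ - M := by
      field_simp; ring
    rw [e] at this
    linarith
  · have := D.loss_eq_neg x (D.sample i)
    have := le_max_left (D.loss x (D.sample i) - τ) 0
    dsimp only
    linarith

theorem CICC_subset_feasibleCVaR (hN : 0 < N) (hnrm : ∀ v, D.nrm v = 0 → v = 0)
    (hθ : 0 ≤ D.θ) (hε0 : 0 < D.ε) {x : Fin L → ℝ} {s : Fin N → ℝ} {t : ℝ}
    (h : (x, s, t) ∈ D.CICC fun _ => 1) : x ∈ D.feasibleCVaR := by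
  obtain ⟨hxX, hs, ht, hi⟩ := h
  dsimp only at hxX hs ht hi
  have hNR : (0 : ℝ) < N := by exact_mod_cast hN
  refine ⟨hxX, iSup₂_le fun P hP => (iInf_le _ (-t)).trans ?_⟩
  set v := D.b - D.Aᵀ *ᵥ x with hv
  have hm : Measurable fun ξ => ENNReal.ofReal (max (D.loss x ξ - -t) 0) :=
    (((D.measurable_loss x).sub_const (-t)).max measurable_const).ennreal_ofReal
  have hq := dualNorm_nonneg D.nrm hnrm v
  have hW := lintegral_le_add_mul_wassersteinDist D.nrm hm hm
    (C := ENNReal.ofReal (dualNorm D.nrm v)) ENNReal.ofReal_ne_top ENNReal.ofReal_ne_top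
    (fun y z => by
      rw [← ENNReal.ofReal_mul hq,
        ← ENNReal.ofReal_add (le_max_right _ _) (mul_nonneg hq (apply_nonneg _ _))]
      refine ENNReal.ofReal_le_ofReal (max_le ?_
        (add_nonneg (le_max_right _ _) (mul_nonneg hq (apply_nonneg _ _))))
      have h1 := dotProduct_le_dualNorm_mul D.nrm hnrm v (z - y)
      rw [map_sub_rev] at h1
      have h2 := D.loss_add x z (y - z)
      rw [add_sub_cancel, ← hv, ← neg_sub z y, dotProduct_neg] at h2
      have h3 := le_max_left (D.loss x z - -t) 0
      linarith) hP.2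
  rw [lintegral_empiricalMeasure, ← ENNReal.ofReal_sum_of_nonneg fun i _ => le_max_right _ _,
    ← ENNReal.ofReal_natCast, ← ENNReal.ofReal_inv_of_pos hNR,
    ← ENNReal.ofReal_mul (by positivity), ← ENNReal.ofReal_mul hq,
    ← ENNReal.ofReal_add (by positivity) (by positivity)] at hW
  have hle : (N : ℝ)⁻¹ * ∑ i, max (D.loss x (D.sample i) - -t) 0 + dualNorm D.nrm v * D.θ
      ≤ D.ε * t := by
    have hsum : ∑ i, max (D.loss x (D.sample i) - -t) 0 ≤ ∑ i, s i :=
      Finset.sum_le_sum fun i _ => max_le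
        (by have := D.loss_eq_neg x (D.sample i); have := hi i; linarith) (hs i)
    rw [← mul_le_mul_iff_right₀ hNR, mul_add, mul_inv_cancel_left₀ hNR.ne']
    linarith
  have hE := ENNReal.div_le_div_right (hW.trans (ENNReal.ofReal_le_ofReal hle))
    (ENNReal.ofReal D.ε)
  rw [← ENNReal.ofReal_div_of_pos hε0, mul_div_cancel_left₀ _ hε0.ne'] at hE
  -- Without this, `ENNReal.ofReal t` would truncate and not cancel -t.
  have ht0 : 0 ≤ t := by
    have : 0 ≤ D.ε * t := le_trans (by positivity) hle
    exact nonneg_of_mul_nonneg_right this hε0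
  calc _ ≤ ((-t : ℝ) : EReal) + ((ENNReal.ofReal t : ℝ≥0∞) : EReal) := by
        gcongr
        exact EReal.coe_ennreal_le_coe_ennreal_iff.mpr hE
    _ = 0 := by
        rw [EReal.coe_ennreal_ofReal, max_eq_left ht0, ← EReal.coe_add]
        simp

theorem isClosed_dualFeasible (hX : IsClosed D.X) : IsClosed D.dualFeasible := by
  have : D.dualFeasible = D.X ∩ ⋂ w ∈ tailWeights N D.ε, ⋂ u, ⋂ (_ : D.nrm u ≤ 1),
      {x | ∑ i, w i * D.loss x (D.sample i) + D.θ * ((D.b - D.Aᵀ *ᵥ x) ⬝ᵥ u) ≤ 0} := by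
    ext x; simp [dualFeasible]
  rw [this]
  refine hX.inter (isClosed_biInter fun w _ => isClosed_iInter fun u => isClosed_iInter fun _ =>
    isClosed_le ?_ continuous_const)
  unfold loss
  fun_prop

end ICCProgram

theorem mainTheorem1 {K L N : ℕ} (hN : 0 < N) (D : ICCProgram K L N)
    (hX : IsPolyhedron D.X) (hXc : IsCompact D.X)
    (hnrm : ∀ v, D.nrm v = 0 → v = 0)
    (hθ : 0 ≤ D.θ) (hε0 : 0 < D.ε) (hε1 : D.ε ≤ 1) :
    D.ZCVaR = D.ZICC (fun _ => 1) ∧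
    (D.feasibleCVaR.Nonempty →
      ∃ x ∈ D.feasibleCVaR, IsMinOn (fun x' => D.c ⬝ᵥ x') D.feasibleCVaR x) ∧
    ((D.CICC (fun _ => 1)).Nonempty →
      ∃ y ∈ D.CICC (fun _ => 1), IsMinOn (fun y' => D.c ⬝ᵥ y'.1) (D.CICC (fun _ => 1)) y) := by
  have hlift : ∀ x ∈ D.feasibleCVaR, ∃ s t, (x, s, t) ∈ D.CICC fun _ => 1 := fun x hx =>
    D.dualFeasible_subset_CICC hN hθ hε0 hε1 (D.feasibleCVaR_subset_dualFeasible hN hθ hε0 hx)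
  have hproj : ∀ y ∈ D.CICC (fun _ => 1), y.1 ∈ D.feasibleCVaR := fun y hy =>
    D.CICC_subset_feasibleCVaR hN hnrm hθ hε0 hy
  have heq : D.feasibleCVaR = D.dualFeasible :=
    (D.feasibleCVaR_subset_dualFeasible hN hθ hε0).antisymm fun x hx =>
      let ⟨_, _, h⟩ := D.dualFeasible_subset_CICC hN hθ hε0 hε1 hx
      hproj _ h
  have hcomp : IsCompact D.feasibleCVaR :=
    hXc.of_isClosed_subset (heq ▸ D.isClosed_dualFeasible hXc.isClosed) fun _ hx => hx.1
  have hmin : D.feasibleCVaR.Nonempty →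
      ∃ x ∈ D.feasibleCVaR, IsMinOn (fun x' => D.c ⬝ᵥ x') D.feasibleCVaR x := fun hne =>
    hcomp.exists_isMinOn hne (by fun_prop)
  refine ⟨le_antisymm ?_ ?_, hmin, ?_⟩
  · exact le_iInf₂ fun y hy => iInf₂_le y.1 (hproj y hy)
  · refine le_iInf₂ fun x hx => ?_
    obtain ⟨s, t, h⟩ := hlift x hx
    exact iInf₂_le (x, s, t) h
  -- The objective ignores s and t, so any lift of an optimal x is optimal; compactness of `CICC` is
  -- not needed.
  · rintro ⟨y, hy⟩
    obtain ⟨x, hx, hxmin⟩ := hmin ⟨_, hproj y hy⟩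
    obtain ⟨s, t, h⟩ := hlift x hx
    exact ⟨_, h, fun y' hy' => hxmin (hproj y' hy')⟩
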